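/- Let $G$ be a group that is amenable as a discrete group, i.e. there is a state $m$ (a positive linear functional with $m(1)=1$) on the algebra $\ell^\infty(G)$ of all bounded functions $G\to\mathbb C$ such that $m(f_x)=m(f)$ for all $x\in G$ and $f\in\ell^\infty(G)$, where $f_x(y)=f(yx)$. Let $S\subset G$ be symmetric, i.e. $e\in S$ and $S^{-1}=S$. Let $\Gamma(G,S)$ be the Cayley graph, whose vertices are the elements of $G$ and in which $\{x,y\}$ with $x\neq y$ is an edge iff $x^{-1}y\in S$. Assume that $\Gamma(G,S)$ is chordal, i.e. every finite simple cycle of length at least $4$ has a chord (an edge connecting two nonconsecutive vertices of the cycle). Let $\mathcal H$ be a complex Hilbert space, let $\mathcal L(\mathcal H)$ be the algebra of bounded operators on it, and let $\phi:S\to\mathcal L(\mathcal H)$ be positive definite on $S$: whenever $g_1,\dots,g_n\in G$ satisfy $g_i^{-1}g_j\in S$ for all $i,j$, the operator matrix $\{\phi(g_i^{-1}g_j)\}_{i,j=1}^n$ is positive semidefinite on $\mathcal H^n$. Then there is a function $\Phi:G\to\mathcal L(\mathcal H)$ with $\Phi(s)=\phi(s)$ for all $s\in S$ which is positive definite on $G$: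 for all $g_1,\dots,g_n\in G$ the operator matrix $\{\Phi(g_i^{-1}g_j)\}_{i,j=1}^n$ is positive semidefinite. -/

import Mathlib

open scoped ComplexOrder ENNReal

namespace PosDefExtension

section Amenability

variable {G : Type*} [Group G]

/-- The right translate `f_x(y) = f(y x)` of a bounded function `f : G → ℂ`. -/
def rightTranslate (x : G) (f : lp (fun _ : G => ℂ) ∞) : lp (fun _ : G => ℂ) ∞ :=
  ⟨fun y => f (y * x), by
    refine memℓp_infty ⟨‖f‖, ?_⟩
    rintro _ ⟨y, rfl⟩
    exact lp.norm_apply_le_norm ENNReal.top_ne_zero f (y * x)⟩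

/-- A right invariant mean on `G` (as a discrete group): a state (a positive unital linear
functional) on the algebra `ℓ^∞(G)` of bounded complex functions, invariant under right
translations. -/
structure IsRightInvariantMean (m : lp (fun _ : G => ℂ) ∞ →ₗ[ℂ] ℂ) : Prop where
  nonneg : ∀ f : lp (fun _ : G => ℂ) ∞, (∀ y, 0 ≤ f y) → 0 ≤ m f
  map_one : m 1 = 1
  invariant : ∀ (x : G) (f : lp (fun _ : G => ℂ) ∞), m (rightTranslate x f) = m f

variable (G) in
/-- `G` is amenable if it carries a right invariant mean. -/
def IsAmenable : Prop :=
  ∃ m : lp (fun _ : G => ℂ) ∞ →ₗ[ℂ] ℂ, IsRightInvariantMean m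

end Amenability

/-- A graph is chordal if every finite simple cycle of length at least `4` has a chord: an edge of
the graph that joins two vertices of the cycle which are not consecutive on it. -/
def IsChordal {V : Type*} (Γ : SimpleGraph V) : Prop :=
  ∀ (v : V) (c : Γ.Walk v v), c.IsCycle → 4 ≤ c.length →
    ∃ x ∈ c.support, ∃ y ∈ c.support, Γ.Adj x y ∧ s(x, y) ∉ c.edges

/-- A symmetric subset of a group: it contains the identity and equals its set of inverses. -/
def IsSymmetricSet {G : Type*} [Group G] (S : Set G) : Prop :=
  1 ∈ S ∧ ∀ x, x⁻¹ ∈ S ↔ x ∈ S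

section PositiveDefinite

variable {G : Type*} [Group G] {H : Type*} [NormedAddCommGroup H] [InnerProductSpace ℂ H]

/-- The operator matrix `A = (A i j)` is positive semidefinite on `H ^ n`: its quadratic form
`⟨A ξ, ξ⟩ = ∑ i, ∑ j, ⟨A i j (ξ j), ξ i⟩` is real and nonnegative. (Mathlib's inner product is
conjugate linear in its first argument.) -/
def OpPosSemidef {n : ℕ} (A : Matrix (Fin n) (Fin n) (H →L[ℂ] H)) : Prop :=
  ∀ ξ : Fin n → H, 0 ≤ ∑ i, ∑ j, inner ℂ (ξ i) (A i j (ξ j))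

/-- A positive definite operator-valued function on the group `G`. -/
def IsPosDef (Φ : G → H →L[ℂ] H) : Prop :=
  ∀ (n : ℕ) (g : Fin n → G), OpPosSemidef (Matrix.of fun i j => Φ ((g i)⁻¹ * g j))

/-- A (partially) positive definite operator-valued function on the subset `S` of `G`. -/
def IsPosDefOn (S : Set G) (φ : S → H →L[ℂ] H) : Prop :=
  ∀ (n : ℕ) (g : Fin n → G) (hg : ∀ i j, (g i)⁻¹ * g j ∈ S),
    OpPosSemidef (Matrix.of fun i j => φ ⟨(g i)⁻¹ * g j, hg i j⟩)

end PositiveDefinite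

end PosDefExtension

/-! The values `φ (x⁻¹ * y)` form an operator kernel prescribed only on the diagonal and on the
edges of the Cayley graph. The proof completes this kernel on all of `G × G` and then averages the
completion into a function of `x⁻¹ * y`.

Completion over a finite vertex set is by induction. On a clique the kernel is fully prescribed and
positive, hence a Gram kernel. A non-clique splits into two proper subsets that meet in a clique,
with no edges across (`IsChordal.exists_clique_separation`). Gram realizations of the two pieces
agree on the overlap, so a partial isometry glues them (`exists_amalgamation`). The completions are
uniformly bounded, and a limit along an ultrafilter on the finite subsets yields a bounded kernel
`K` on `G` (`IsPosDefOn.exists_kernel`).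

`K` need not be left invariant. Setting `Φ g` to be the mean over `y` of `K y (y * g)` repairs this:
right invariance of the mean turns `Φ (x⁻¹ * z)` into the mean of `K (y * x) (y * z)`, and means
preserve positivity. For `s ∈ S` the averaged function is constantly `φ s`. -/

namespace PosDefExtension

/-! ### Clique separators in chordal graphs -/

section Graph

variable {V : Type*}

/-- The graph on `V` that keeps only the edges of `Γ` with both ends in `W`. -/
def restrictTo (Γ : SimpleGraph V) (W : Set V) : SimpleGraph V where
  Adj x y := Γ.Adj x y ∧ x ∈ W ∧ y ∈ W
  symm := ⟨fun _ _ h => ⟨h.1.symm, h.2.2, h.2.1⟩⟩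
  loopless := ⟨fun _ h => h.1.ne rfl⟩

theorem restrictTo_le (Γ : SimpleGraph V) (W : Set V) : restrictTo Γ W ≤ Γ :=
  fun _ _ h => h.1

theorem restrictTo_mono (Γ : SimpleGraph V) {W W' : Set V} (h : W ⊆ W') :
    restrictTo Γ W ≤ restrictTo Γ W' :=
  fun _ _ hxy => ⟨hxy.1, h hxy.2.1, h hxy.2.2⟩

theorem mem_of_mem_support_restrictTo {Γ : SimpleGraph V} {W : Set V} {u v : V}
    (p : (restrictTo Γ W).Walk u v) (hu : u ∈ W) {x : V} (hx : x ∈ p.support) : x ∈ W := by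
  induction p with
  | nil => simp_all
  | cons h p ih =>
    rw [SimpleGraph.Walk.support_cons, List.mem_cons] at hx
    rcases hx with rfl | hx
    · exact hu
    · exact ih h.2.2 hx

/-- A geodesic has no chords. -/
theorem mem_edges_of_length_eq_dist {Γ : SimpleGraph V} {u v : V} (p : Γ.Walk u v)
    (hp : p.length = Γ.dist u v) {x y : V} (hx : x ∈ p.support) (hy : y ∈ p.support)
    (hxy : Γ.Adj x y) : s(x, y) ∈ p.edges := by
  have key : ∀ i j : ℕ, i ≤ j → j ≤ p.length → Γ.Adj (p.getVert i) (p.getVert j) →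
      s(p.getVert i, p.getVert j) ∈ p.edges := by
    intro i j hij hj hadj
    -- A chord would shortcut the walk; minimality of its length forces `j ≤ i + 1`.
    have hle := SimpleGraph.dist_le ((p.take i).append (.cons hadj (p.drop j)))
    rw [SimpleGraph.Walk.length_append, SimpleGraph.Walk.length_cons,
      SimpleGraph.Walk.take_length, SimpleGraph.Walk.drop_length, ← hp] at hle
    have hne : i ≠ j := by
      rintro rfl
      exact hadj.ne rfl
    obtain rfl : j = i + 1 := by omega
    have := p.toSubgraph_adj_getVert (i := i) (by omega)
    rwa [← SimpleGraph.Walk.mem_edges_toSubgraph, SimpleGraph.Subgraph.mem_edgeSet]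
  obtain ⟨i, rfl, hi⟩ := SimpleGraph.Walk.mem_support_iff_exists_getVert.1 hx
  obtain ⟨j, rfl, hj⟩ := SimpleGraph.Walk.mem_support_iff_exists_getVert.1 hy
  rcases le_total i j with h | h
  · exact key i j h hj hxy
  · rw [Sym2.eq_swap]
    exact key j i h hi hxy.symm

/-- In a chordal graph, two neighbours of `a` that are joined by a walk whose interior avoids the
closed neighbourhood of `a` are adjacent. -/
theorem IsChordal.adj_of_reachable {Γ : SimpleGraph V} (hΓ : IsChordal Γ) {a c c' : V}
    {W : Set V} (hac : Γ.Adj a c) (hac' : Γ.Adj a c') (hne : c ≠ c')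
    (hcW : c ∈ W) (haW : a ∉ W) (hW : ∀ x ∈ W, Γ.Adj a x → x = c ∨ x = c')
    (hreach : (restrictTo Γ W).Reachable c c') : Γ.Adj c c' := by
  by_contra hnadj
  -- A geodesic inside `W`, closed up through `a`, is a cycle of length at least 4. It has no chord:
  -- not from `a`, by `hW`, and not within the geodesic.
  obtain ⟨p, hpath, hp⟩ := hreach.exists_path_of_dist
  have hlt : 1 < p.length :=
    hp ▸ hreach.one_lt_dist_of_ne_of_not_adj hne fun h => hnadj h.1
  set q := p.mapLe (restrictTo_le Γ W) with hq
  have hqpath : q.IsPath := hpath.mapLe _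
  have hsupp : q.support = p.support := by simp [hq]
  have hedges : q.edges = p.edges := by simp [hq]
  have haq : a ∉ q.support := fun h =>
    haW (mem_of_mem_support_restrictTo p hcW (hsupp ▸ h))
  have hcyc : (SimpleGraph.Walk.cons hac (q.concat hac'.symm)).IsCycle := by
    rw [SimpleGraph.Walk.cons_isCycle_iff, SimpleGraph.Walk.edges_concat]
    refine ⟨hqpath.concat haq _, fun h => ?_⟩
    rw [List.concat_eq_append, List.mem_append] at h
    rcases h with h | h
    · exact haq (q.fst_mem_support_of_mem_edges h)
    · simp only [List.mem_singleton, Sym2.eq_iff] at h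
      rcases h with ⟨h, -⟩ | ⟨-, h⟩
      · exact hac'.ne h
      · exact hne h
  obtain ⟨x, hx, y, hy, hxy, hnot⟩ := hΓ a _ hcyc (by
    have : q.length = p.length := by simp [hq]
    simp only [SimpleGraph.Walk.length_cons, SimpleGraph.Walk.length_concat]
    omega)
  simp only [SimpleGraph.Walk.edges_cons, SimpleGraph.Walk.edges_concat, List.concat_eq_append,
    List.mem_cons, List.mem_append, List.not_mem_nil, or_false, not_or] at hnot
  have hmem : ∀ z ∈ (SimpleGraph.Walk.cons hac (q.concat hac'.symm)).support,
      z = a ∨ z ∈ p.support := by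
    intro z hz
    simp only [SimpleGraph.Walk.support_cons, SimpleGraph.Walk.support_concat,
      List.mem_cons, List.mem_append, List.not_mem_nil, or_false] at hz
    rw [← hsupp]
    tauto
  have hapex : ∀ z ∈ p.support, Γ.Adj a z → s(a, z) = s(a, c) ∨ s(a, z) = s(c', a) := by
    intro z hz haz
    rcases hW z (mem_of_mem_support_restrictTo p hcW hz) haz with rfl | rfl
    · exact Or.inl rfl
    · exact Or.inr Sym2.eq_swap
  rcases hmem x hx with rfl | hx' <;> rcases hmem y hy with rfl | hy'
  · exact hxy.ne rfl
  · have := hapex y hy' hxy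
    tauto
  · have := hapex x hx' hxy.symm
    rw [Sym2.eq_swap] at hnot
    tauto
  · refine hnot.2.1 (hedges ▸ mem_edges_of_length_eq_dist p hp hx' hy' ⟨hxy, ?_, ?_⟩)
    · exact mem_of_mem_support_restrictTo p hcW hx'
    · exact mem_of_mem_support_restrictTo p hcW hy'

/-- A finite set of vertices of a chordal graph that is not a clique is the union of two proper
subsets which meet in a clique and between which there are no further edges. -/
theorem IsChordal.exists_clique_separation [DecidableEq V] {Γ : SimpleGraph V}
    (hΓ : IsChordal Γ) (F : Finset V) (hF : ¬ Γ.IsClique (F : Set V)) :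
    ∃ A B : Finset V, A ∪ B = F ∧ A ⊂ F ∧ B ⊂ F ∧ Γ.IsClique (A ∩ B : Set V) ∧
      ∀ x ∈ A, x ∉ B → ∀ y ∈ B, y ∉ A → ¬ Γ.Adj x y := by
  classical
  obtain ⟨a, ha, b, hb, hab, hnadj⟩ : ∃ a ∈ F, ∃ b ∈ F, a ≠ b ∧ ¬ Γ.Adj a b := by
    by_contra! h
    exact hF fun x hx y hy hxy => h x hx y hy hxy
  -- `D` is the component of `b` among the non-neighbours of `a`; its outer boundary `C` in `F` is
  -- the separator.
  set U : Set V := {x | x ∈ F ∧ x ≠ a ∧ ¬ Γ.Adj a x} with hU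
  have hbU : b ∈ U := ⟨hb, hab.symm, hnadj⟩
  set D : Finset V := {x ∈ F | (restrictTo Γ U).Reachable b x} with hD
  have hDU : ∀ x ∈ D, x ∈ U := by
    intro x hx
    obtain ⟨p⟩ := (Finset.mem_filter.1 hx).2
    exact mem_of_mem_support_restrictTo p hbU p.end_mem_support
  have hbD : b ∈ D := Finset.mem_filter.2 ⟨hb, .refl _⟩
  have haD : a ∉ D := fun h => (hDU a h).2.1 rfl
  set C : Finset V := {x ∈ F | x ∉ D ∧ ∃ y ∈ D, Γ.Adj x y} with hC
  have hCa : ∀ c ∈ C, Γ.Adj a c := by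
    intro c hc
    obtain ⟨hcF, hcD, y, hy, hcy⟩ := Finset.mem_filter.1 hc
    by_contra hac
    have hca : c ≠ a := by
      rintro rfl
      exact (hDU y hy).2.2 hcy
    have hcU : c ∈ U := ⟨hcF, hca, hac⟩
    refine hcD (Finset.mem_filter.2 ⟨hcF, (Finset.mem_filter.1 hy).2.trans ?_⟩)
    exact SimpleGraph.Adj.reachable (G := restrictTo Γ U) ⟨hcy.symm, hDU y hy, hcU⟩
  have hCclique : Γ.IsClique (C : Set V) := by
    intro c hc c' hc' hne
    have hc₁ := hCa c hc
    have hc₂ := hCa c' hc'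
    obtain ⟨-, -, y, hy, hcy⟩ := Finset.mem_filter.1 hc
    obtain ⟨-, -, y', hy', hcy'⟩ := Finset.mem_filter.1 hc'
    set W : Set V := insert c (insert c' U) with hW
    have hUW : U ⊆ W := (Set.subset_insert _ _).trans (Set.subset_insert _ _)
    refine hΓ.adj_of_reachable (W := W) hc₁ hc₂ hne (Set.mem_insert _ _) ?_ ?_ ?_
    · rintro (h | h | h)
      · exact hc₁.ne h
      · exact hc₂.ne h
      · exact h.2.1 rfl
    · rintro x (h | h | h) hax
      · exact Or.inl h
      · exact Or.inr h
      · exact absurd hax h.2.2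
    · have h₁ : (restrictTo Γ W).Reachable c y :=
        SimpleGraph.Adj.reachable ⟨hcy, Set.mem_insert _ _, hUW (hDU y hy)⟩
      have h₂ : (restrictTo Γ W).Reachable c' y' := SimpleGraph.Adj.reachable
        ⟨hcy', Set.mem_insert_of_mem _ (Set.mem_insert _ _), hUW (hDU y' hy')⟩
      have h₃ : (restrictTo Γ U).Reachable y y' :=
        (Finset.mem_filter.1 hy).2.symm.trans (Finset.mem_filter.1 hy').2
      exact (h₁.trans (h₃.mono (restrictTo_mono Γ hUW))).trans h₂.symm
  have hDF : D ⊆ F := Finset.filter_subset _ _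
  have hCF : C ⊆ F := Finset.filter_subset _ _
  refine ⟨F \ D, D ∪ C, ?_, ?_, ?_, ?_, ?_⟩
  · ext x
    simp only [Finset.mem_union, Finset.mem_sdiff]
    have := @hDF x
    have := @hCF x
    tauto
  · exact ⟨Finset.sdiff_subset, fun h => (Finset.mem_sdiff.1 (h hb)).2 hbD⟩
  · refine ⟨Finset.union_subset hDF hCF, fun h => ?_⟩
    rcases Finset.mem_union.1 (h ha) with h | h
    · exact haD h
    · exact (hCa a h).ne rfl
  · refine hCclique.subset fun x hx => ?_
    simp only [Finset.coe_sdiff, Finset.coe_union, Set.mem_inter_iff, Set.mem_sdiff,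
      Set.mem_union, Finset.mem_coe] at hx ⊢
    tauto
  · intro x hxA hxB y hyB hyA hxy
    simp only [Finset.mem_union, Finset.mem_sdiff, not_or, not_and, not_not] at hxA hxB hyB hyA
    have hyD : y ∈ D := hyB.elim id fun h => hyA (hCF h)
    exact hxB.2 (Finset.mem_filter.2 ⟨hxA.1, hxA.2, y, hyD, hxy⟩)

end Graph

/-! ### Gluing Gram realizations by a partial isometry -/

section Gluing

variable {V H E₁ E₂ : Type*} [NormedAddCommGroup H] [InnerProductSpace ℂ H]
  [NormedAddCommGroup E₁] [InnerProductSpace ℂ E₁] [CompleteSpace E₁]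
  [NormedAddCommGroup E₂] [InnerProductSpace ℂ E₂] [CompleteSpace E₂]

/-- If `‖X d‖ = ‖Y d‖` for all `d`, then `X d ↦ Y d` is implemented by a partial isometry `J`; the
projection `Q` is the defect operator of `J`. -/
theorem exists_partialIsometry {D : Type*} [AddCommGroup D] [Module ℂ D] (X : D →ₗ[ℂ] E₂)
    (Y : D →ₗ[ℂ] E₁) (hXY : ∀ d, ‖Y d‖ = ‖X d‖) :
    ∃ (J : E₂ →L[ℂ] E₁) (Q : E₂ →L[ℂ] E₂), (∀ d, J (X d) = Y d) ∧ (∀ d, Q (X d) = 0) ∧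
      ∀ u v, inner ℂ (J u) (J v) + inner ℂ (Q u) (Q v) = inner ℂ u v := by
  set M : Submodule ℂ E₂ := (LinearMap.range X).topologicalClosure with hM
  have : CompleteSpace M :=
    (Submodule.isClosed_topologicalClosure _).completeSpace_coe
  have hXM : ∀ d, X d ∈ M := fun d => subset_closure (LinearMap.mem_range_self X d)
  set e : D →ₗ[ℂ] M := X.codRestrict M hXM with he
  have hdense : DenseRange e := by
    intro z
    have hz : (z : E₂) ∈ closure (Set.range X) := z.2
    rw [Metric.mem_closure_iff] at hz ⊢
    intro ε hε
    obtain ⟨_, ⟨d, rfl⟩, hd⟩ := hz ε hε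
    exact ⟨e d, ⟨d, rfl⟩, hd⟩
  have hbound : ∀ d, ‖Y d‖ ≤ 1 * ‖e d‖ := fun d => by
    rw [one_mul, hXY]
    exact le_rfl
  set T : M →L[ℂ] E₁ := Y.extendOfNorm e with hT
  have hTe : ∀ d, T (e d) = Y d := LinearMap.extendOfNorm_eq hdense ⟨1, hbound⟩
  have hTnorm : ∀ z, ‖T z‖ = ‖z‖ := by
    intro z
    refine hdense.induction_on (p := fun z => ‖T z‖ = ‖z‖) z
      (isClosed_eq (by fun_prop) (by fun_prop)) fun d => ?_
    rw [hTe, hXY]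
    rfl
  let Ti : M →ₗᵢ[ℂ] E₁ := ⟨T.toLinearMap, hTnorm⟩
  have hTinner : ∀ u v, inner ℂ (T u) (T v) = inner ℂ u v := Ti.inner_map_map
  -- The inner product identity is Pythagoras for `M` and `Mᗮ`, as `T` is isometric on `M`.
  refine ⟨T ∘L M.orthogonalProjectionOnto, Mᗮ.starProjection, fun d => ?_, fun d => ?_,
    fun u v => ?_⟩
  · rw [ContinuousLinearMap.comp_apply, ← hTe d]
    congr 1
    exact M.orthogonalProjectionOnto_mem_subspace_eq_self (e d)
  · rw [Submodule.starProjection_orthogonal_apply_eq_zero (hXM d)]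
  · have h : ∀ w : E₂, w = M.starProjection w + Mᗮ.starProjection w := fun w =>
      (Submodule.starProjection_add_starProjection_orthogonal (K := M) w).symm
    have h₁ : ∀ a b : E₂, inner ℂ (M.starProjection a) (Mᗮ.starProjection b) = 0 := fun a b =>
      Submodule.inner_right_of_mem_orthogonal (M.starProjection_apply_mem a)
        (Mᗮ.starProjection_apply_mem b)
    have h₂ : ∀ a b : E₂, inner ℂ (Mᗮ.starProjection b) (M.starProjection a) = 0 := fun a b =>
      Submodule.inner_left_of_mem_orthogonal (M.starProjection_apply_mem a)
        (Mᗮ.starProjection_apply_mem b)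
    conv_rhs => rw [h u, h v]
    rw [inner_add_left, inner_add_right, inner_add_right, h₁, h₂, add_zero, zero_add,
      ContinuousLinearMap.comp_apply, ContinuousLinearMap.comp_apply, hTinner]
    rfl

/-- Amalgamation of two families of operators which have the same Gram matrix on `A ∩ B`. -/
theorem exists_amalgamation (A B : Set V) (W₁ : V → H →L[ℂ] E₁) (W₂ : V → H →L[ℂ] E₂)
    (hW : ∀ x ∈ A ∩ B, ∀ y ∈ A ∩ B, ∀ ξ η,
      inner ℂ (W₁ x ξ) (W₁ y η) = inner ℂ (W₂ x ξ) (W₂ y η)) :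
    ∃ W : V → H →L[ℂ] WithLp 2 (E₁ × E₂),
      (∀ x ∈ A, ∀ y ∈ A, ∀ ξ η, inner ℂ (W x ξ) (W y η) = inner ℂ (W₁ x ξ) (W₁ y η)) ∧
      ∀ x ∈ B, ∀ y ∈ B, ∀ ξ η, inner ℂ (W x ξ) (W y η) = inner ℂ (W₂ x ξ) (W₂ y η) := by
  classical
  let X : ((A ∩ B : Set V) →₀ H) →ₗ[ℂ] E₂ := Finsupp.lsum ℂ fun c => (W₂ c).toLinearMap
  let Y : ((A ∩ B : Set V) →₀ H) →ₗ[ℂ] E₁ := Finsupp.lsum ℂ fun c => (W₁ c).toLinearMap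
  have hXY : ∀ d, ‖Y d‖ = ‖X d‖ := by
    intro d
    have : inner ℂ (Y d) (Y d) = inner ℂ (X d) (X d) := by
      simp only [X, Y, Finsupp.lsum_apply, Finsupp.sum, sum_inner, inner_sum,
        ContinuousLinearMap.coe_coe]
      exact Finset.sum_congr rfl fun i _ => Finset.sum_congr rfl fun j _ =>
        hW _ j.2 _ i.2 _ _
    rw [inner_self_eq_norm_sq_to_K, inner_self_eq_norm_sq_to_K] at this
    exact (sq_eq_sq₀ (norm_nonneg _) (norm_nonneg _)).1 (by exact_mod_cast this)
  obtain ⟨J, Q, hJ, hQ, hJQ⟩ := exists_partialIsometry X Y hXY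
  let pair (u : H →L[ℂ] E₁) (v : H →L[ℂ] E₂) : H →L[ℂ] WithLp 2 (E₁ × E₂) :=
    (WithLp.prodContinuousLinearEquiv 2 ℂ E₁ E₂).symm.toContinuousLinearMap ∘L u.prod v
  have hpair : ∀ u v u' v' ξ η, inner ℂ (pair u v ξ) (pair u' v' η) =
      inner ℂ (u ξ) (u' η) + inner ℂ (v ξ) (v' η) := fun _ _ _ _ _ _ =>
    WithLp.prod_inner_apply _ _
  -- The pair `(J, Q)` is an isometry, so the second branch preserves the Gram matrix of `W₂`. On `A
  -- ∩ B` the branches coincide.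
  refine ⟨fun x => if x ∈ A then pair (W₁ x) 0 else pair (J ∘L W₂ x) (Q ∘L W₂ x), ?_, ?_⟩
  · intro x hx y hy ξ η
    simp only [hx, hy, if_true, hpair]
    simp
  · have hB : ∀ x ∈ B, (if x ∈ A then pair (W₁ x) 0 else pair (J ∘L W₂ x) (Q ∘L W₂ x)) =
        pair (J ∘L W₂ x) (Q ∘L W₂ x) := by
      intro x hx
      split_ifs with hxA
      · have h₁ : J ∘L W₂ x = W₁ x := by
          ext ξ
          simpa [X, Y] using hJ (Finsupp.single ⟨x, hxA, hx⟩ ξ)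
        have h₂ : Q ∘L W₂ x = 0 := by
          ext ξ
          simpa [X, Y] using hQ (Finsupp.single ⟨x, hxA, hx⟩ ξ)
        rw [h₁, h₂]
      · rfl
    intro x hx y hy ξ η
    simp only [hB x hx, hB y hy, hpair, ContinuousLinearMap.comp_apply, hJQ]

end Gluing

/-! ### States on bounded functions and weak operator averages -/

section Averaging

variable {ι : Type*}

/-- A state on `ℓ^∞(ι)`: a positive unital linear functional. -/
structure IsState (m : lp (fun _ : ι => ℂ) ∞ →ₗ[ℂ] ℂ) : Prop where
  nonneg : ∀ f : lp (fun _ : ι => ℂ) ∞, (∀ y, 0 ≤ f y) → 0 ≤ m f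
  map_one : m 1 = 1

theorem IsRightInvariantMean.isState {G : Type*} [Group G] {m : lp (fun _ : G => ℂ) ∞ →ₗ[ℂ] ℂ}
    (hm : IsRightInvariantMean m) : IsState m :=
  ⟨hm.nonneg, hm.map_one⟩

theorem memℓp_infty_of_norm_le {f : ι → ℂ} {C : ℝ} (hf : ∀ i, ‖f i‖ ≤ C) : Memℓp f ∞ :=
  memℓp_infty ⟨C, by rintro _ ⟨i, rfl⟩; exact hf i⟩

/-- Positivity on `C + f` and `C - f`. -/
theorem IsState.norm_le_of_real {m : lp (fun _ : ι => ℂ) ∞ →ₗ[ℂ] ℂ} (hm : IsState m)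
    {f : lp (fun _ : ι => ℂ) ∞} {C : ℝ} (r : ι → ℝ) (hr : ∀ i, f i = r i)
    (hC : ∀ i, |r i| ≤ C) : ‖m f‖ ≤ C := by
  have h₁ : 0 ≤ m ((C : ℂ) • 1 + f) := hm.nonneg _ fun i => by
    have : ((C : ℂ) • (1 : lp (fun _ : ι => ℂ) ∞) + f) i = ((C + r i : ℝ) : ℂ) := by
      change (C : ℂ) * 1 + f i = _
      rw [hr]
      push_cast
      ring
    rw [this, Complex.zero_le_real]
    linarith [(abs_le.1 (hC i)).1]
  have h₂ : 0 ≤ m ((C : ℂ) • 1 - f) := hm.nonneg _ fun i => by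
    have : ((C : ℂ) • (1 : lp (fun _ : ι => ℂ) ∞) - f) i = ((C - r i : ℝ) : ℂ) := by
      change (C : ℂ) * 1 - f i = _
      rw [hr]
      push_cast
      ring
    rw [this, Complex.zero_le_real]
    linarith [(abs_le.1 (hC i)).2]
  rw [map_add, map_smul, hm.map_one, Complex.nonneg_iff] at h₁
  rw [map_sub, map_smul, hm.map_one, Complex.nonneg_iff] at h₂
  simp only [smul_eq_mul, mul_one, Complex.add_re, Complex.sub_re, Complex.ofReal_re,
    Complex.add_im, Complex.ofReal_im, zero_add] at h₁ h₂
  have : m f = ((m f).re : ℂ) := Complex.ext rfl (by simp [← h₁.2])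
  rw [this, Complex.norm_real, Real.norm_eq_abs, abs_le]
  constructor <;> linarith [h₁.1, h₂.1]

/-- The factor 2 comes from treating real and imaginary parts separately; only boundedness matters
later. -/
theorem IsState.norm_le {m : lp (fun _ : ι => ℂ) ∞ →ₗ[ℂ] ℂ} (hm : IsState m)
    {f : lp (fun _ : ι => ℂ) ∞} {C : ℝ} (hf : ∀ i, ‖f i‖ ≤ C) : ‖m f‖ ≤ 2 * C := by
  have hre : ∀ i, |(f i).re| ≤ C := fun i => (Complex.abs_re_le_norm _).trans (hf i)
  have him : ∀ i, |(f i).im| ≤ C := fun i => (Complex.abs_im_le_norm _).trans (hf i)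
  let a : lp (fun _ : ι => ℂ) ∞ := ⟨fun i => ((f i).re : ℂ),
    memℓp_infty_of_norm_le (C := C) fun i => by simpa using hre i⟩
  let b : lp (fun _ : ι => ℂ) ∞ := ⟨fun i => ((f i).im : ℂ),
    memℓp_infty_of_norm_le (C := C) fun i => by simpa using him i⟩
  have hab : f = a + Complex.I • b := by
    ext i
    change f i = ((f i).re : ℂ) + Complex.I * ((f i).im : ℂ)
    rw [mul_comm, Complex.re_add_im]
  have ha : ‖m a‖ ≤ C := hm.norm_le_of_real _ (fun _ => rfl) hre
  have hb : ‖m b‖ ≤ C := hm.norm_le_of_real _ (fun _ => rfl) him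
  rw [hab, map_add, map_smul]
  refine (norm_add_le _ _).trans ?_
  rw [norm_smul, Complex.norm_I, one_mul]
  linarith

/-- The limit along an ultrafilter is a state. -/
theorem exists_isState_of_ultrafilter (U : Ultrafilter ι) :
    ∃ m : lp (fun _ : ι => ℂ) ∞ →ₗ[ℂ] ℂ, IsState m ∧
      ∀ (f : lp (fun _ : ι => ℂ) ∞) (c : ℂ), (∀ᶠ i in (U : Filter ι), f i = c) → m f = c := by
  have hlim : ∀ f : lp (fun _ : ι => ℂ) ∞, ∃ a, Filter.Tendsto (f : ι → ℂ) U (nhds a) := by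
    intro f
    obtain ⟨a, -, ha⟩ := (isCompact_closedBall (0 : ℂ) ‖f‖).ultrafilter_le_nhds
      (U.map (f : ι → ℂ)) (by
        rw [Ultrafilter.coe_map, Filter.le_principal_iff, Filter.mem_map]
        refine Filter.univ_mem' fun i => ?_
        simpa using lp.norm_apply_le_norm ENNReal.top_ne_zero f i)
    exact ⟨a, ha⟩
  choose L hL using hlim
  have huniq : ∀ (f : lp (fun _ : ι => ℂ) ∞) a, Filter.Tendsto (f : ι → ℂ) U (nhds a) → L f = a := fun f a h =>
    tendsto_nhds_unique (hL f) h
  refine ⟨⟨⟨L, fun f g => huniq _ _ ((hL f).add (hL g))⟩,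
    fun c f => huniq _ _ ((hL f).const_mul c)⟩, ⟨fun f hf => ?_, ?_⟩, fun f c hc => ?_⟩
  · exact ge_of_tendsto' (hL f) hf
  · exact huniq _ _ tendsto_const_nhds
  · exact huniq _ _ (tendsto_const_nhds.congr' (hc.mono fun _ h => h.symm))

variable {H : Type*} [NormedAddCommGroup H] [InnerProductSpace ℂ H]

/-- The operator `A` is the weak average of the bounded family of operators `T` with respect to
`m`. -/
def IsAverage (m : lp (fun _ : ι => ℂ) ∞ →ₗ[ℂ] ℂ) (T : ι → H →L[ℂ] H) (A : H →L[ℂ] H) : Prop :=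
  ∀ ξ η : H, ∃ h : Memℓp (fun i => inner ℂ ξ (T i η)) ∞, inner ℂ ξ (A η) = m ⟨_, h⟩

theorem norm_inner_apply_le {T : H →L[ℂ] H} {C : ℝ} (hT : ‖T‖ ≤ C) (ξ η : H) :
    ‖(inner ℂ ξ (T η) : ℂ)‖ ≤ C * ‖ξ‖ * ‖η‖ :=
  calc ‖(inner ℂ ξ (T η) : ℂ)‖ ≤ ‖ξ‖ * ‖T η‖ := norm_inner_le_norm _ _
    _ ≤ ‖ξ‖ * (C * ‖η‖) := by gcongr; exact T.le_of_opNorm_le hT η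
    _ = C * ‖ξ‖ * ‖η‖ := by ring

/-- Averaging matrix coefficients gives a bounded sesquilinear form, which Riesz representation
turns into an operator. -/
theorem IsState.exists_isAverage [CompleteSpace H] {m : lp (fun _ : ι => ℂ) ∞ →ₗ[ℂ] ℂ}
    (hm : IsState m) {T : ι → H →L[ℂ] H} {C : ℝ} (hT : ∀ i, ‖T i‖ ≤ C) :
    ∃ A, IsAverage m T A := by
  have hmem : ∀ ξ η : H, Memℓp (fun i => (inner ℂ ξ (T i η) : ℂ)) ∞ := fun ξ η =>
    memℓp_infty_of_norm_le fun i => norm_inner_apply_le (hT i) ξ η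
  let B₀ : H →ₗ⋆[ℂ] H →ₗ[ℂ] ℂ := LinearMap.mk₂'ₛₗ (starRingEnd ℂ) (RingHom.id ℂ)
    (fun ξ η => m ⟨_, hmem ξ η⟩)
    (fun ξ ξ' η => by
      rw [← map_add]
      congr 1
      ext i
      exact inner_add_left _ _ _)
    (fun c ξ η => by
      rw [← map_smul]
      congr 1
      ext i
      exact inner_smul_left _ _ _)
    (fun ξ η η' => by
      rw [← map_add]
      congr 1
      ext i
      change inner ℂ ξ (T i (η + η')) = inner ℂ ξ (T i η) + inner ℂ ξ (T i η')
      rw [map_add, inner_add_right])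
    (fun c ξ η => by
      rw [RingHom.id_apply, ← map_smul]
      congr 1
      ext i
      change inner ℂ ξ (T i (c • η)) = c * inner ℂ ξ (T i η)
      rw [map_smul, inner_smul_right])
  let B : H →L⋆[ℂ] H →L[ℂ] ℂ := B₀.mkContinuous₂ (2 * C) fun ξ η => by
    refine (hm.norm_le (C := C * ‖ξ‖ * ‖η‖) fun i => norm_inner_apply_le (hT i) ξ η).trans_eq ?_
    ring
  refine ⟨(InnerProductSpace.continuousLinearMapOfBilin B).adjoint, fun ξ η => ⟨hmem ξ η, ?_⟩⟩
  rw [ContinuousLinearMap.adjoint_inner_right,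
    InnerProductSpace.continuousLinearMapOfBilin_apply]
  rfl

theorem IsState.opPosSemidef {m : lp (fun _ : ι => ℂ) ∞ →ₗ[ℂ] ℂ} (hm : IsState m) {n : ℕ}
    {T : Fin n → Fin n → ι → H →L[ℂ] H} {A : Fin n → Fin n → H →L[ℂ] H}
    (hA : ∀ i j, IsAverage m (T i j) (A i j))
    (hT : ∀ y, OpPosSemidef (Matrix.of fun i j => T i j y)) : OpPosSemidef (Matrix.of A) := by
  intro ξ
  choose h₁ h₂ using fun i j => hA i j (ξ i) (ξ j)
  simp only [Matrix.of_apply, h₂]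
  simp only [← map_sum]
  refine hm.nonneg _ fun y => ?_
  have hsum : ∀ f : Fin n → lp (fun _ : ι => ℂ) ∞,
      (∑ i, f i : lp _ _) y = ∑ i, f i y := fun f => by
    rw [lp.coeFn_sum]
    exact Finset.sum_apply y Finset.univ fun i => (f i : ι → ℂ)
  simp only [hsum]
  exact hT y ξ

theorem IsAverage.norm_le {m : lp (fun _ : ι => ℂ) ∞ →ₗ[ℂ] ℂ} (hm : IsState m)
    {T : ι → H →L[ℂ] H} {A : H →L[ℂ] H} (hA : IsAverage m T A) {C : ℝ} (hC : 0 ≤ C)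
    (hT : ∀ i, ‖T i‖ ≤ C) : ‖A‖ ≤ 2 * C := by
  refine A.opNorm_le_bound (by positivity) fun η => ?_
  obtain ⟨h, hAη⟩ := hA (A η) η
  have hle := hm.norm_le (f := ⟨_, h⟩) fun i => norm_inner_apply_le (hT i) (A η) η
  rw [← hAη, inner_self_eq_norm_sq_to_K, norm_pow, RCLike.norm_ofReal, abs_norm] at hle
  rcases (norm_nonneg (A η)).eq_or_lt with h₀ | h₀
  · rw [← h₀]
    positivity
  · refine le_of_mul_le_mul_left ?_ h₀
    linarith

theorem IsAverage.comp_mul_right {G : Type*} [Group G] {m : lp (fun _ : G => ℂ) ∞ →ₗ[ℂ] ℂ}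
    (hm : IsRightInvariantMean m) {T : G → H →L[ℂ] H} {A : H →L[ℂ] H} (hA : IsAverage m T A)
    (x : G) : IsAverage m (fun y => T (y * x)) A := by
  intro ξ η
  obtain ⟨h, h'⟩ := hA ξ η
  refine ⟨(rightTranslate x ⟨_, h⟩).2, ?_⟩
  rw [h', ← hm.invariant x]
  rfl

end Averaging

universe u v

/-! ### From finite cliques to a positive definite kernel on the group -/

section Extension

variable {G : Type*} [Group G] {S : Set G} {H : Type*} [NormedAddCommGroup H]
  [InnerProductSpace ℂ H] {φ : S → H →L[ℂ] H}

theorem IsSymmetricSet.mem_of_isClique (hS : IsSymmetricSet S) {F : Set G}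
    (hF : (SimpleGraph.mulCayley S).IsClique F) {x y : G} (hx : x ∈ F) (hy : y ∈ F) :
    x⁻¹ * y ∈ S := by
  by_cases hxy : x = y
  · simpa [hxy] using hS.1
  · rcases (SimpleGraph.mulCayley_adj S x y).1 (hF hx hy hxy) with ⟨-, h | h⟩
    · exact h
    · simpa using (hS.2 _).2 h

/-- If the quadratic form of a `2 × 2` operator matrix is real valued, then its off-diagonal
entries are adjoint to each other. -/
theorem inner_eq_of_opPosSemidef {A : Matrix (Fin 2) (Fin 2) (H →L[ℂ] H)}
    (hA : OpPosSemidef A) (ξ η : H) : inner ℂ (A 1 0 ξ) η = inner ℂ ξ (A 0 1 η) := by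
  have him : ∀ a b : H, (inner ℂ a (A 0 1 b)).im + (inner ℂ b (A 1 0 a)).im = 0 := by
    intro a b
    have h₁ := (Complex.nonneg_iff.1 (hA ![a, b])).2
    have h₂ := (Complex.nonneg_iff.1 (hA ![a, 0])).2
    have h₃ := (Complex.nonneg_iff.1 (hA ![0, b])).2
    simp [Fin.sum_univ_two] at h₁ h₂ h₃
    linarith
  have h₁ := him ξ η
  -- Polarization: `ξ` gives the imaginary parts, `I • ξ` the real parts.
  have h₂ := him (Complex.I • ξ) η
  rw [map_smul, inner_smul_left, inner_smul_right] at h₂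
  simp at h₂
  rw [← inner_conj_symm]
  refine Complex.ext ?_ ?_
  · rw [Complex.conj_re]
    linarith
  · rw [Complex.conj_im]
    linarith

/-- Kolmogorov decomposition of a partially positive definite function over a finite clique. -/
theorem IsPosDefOn.exists_gram_of_isClique {G : Type u} [Group G] {S : Set G} {H : Type v}
    [NormedAddCommGroup H] [InnerProductSpace ℂ H] [CompleteSpace H] {φ : S → H →L[ℂ] H}
    (hφ : IsPosDefOn S φ) (F : Finset G) (hF : ∀ x ∈ F, ∀ y ∈ F, x⁻¹ * y ∈ S) :
    ∃ (E : Type (max u v)) (_ : NormedAddCommGroup E) (_ : InnerProductSpace ℂ E)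
      (_ : CompleteSpace E) (W : G → H →L[ℂ] E), ∀ x ∈ F, ∀ y ∈ F, ∀ h : x⁻¹ * y ∈ S,
        ∀ ξ η, inner ℂ (W x ξ) (W y η) = inner ℂ ξ (φ ⟨x⁻¹ * y, h⟩ η) := by
  classical
  let K : Matrix F F (H →L[ℂ] H) := 
    Matrix.of fun x y => φ ⟨(x : G)⁻¹ * (y : G), hF x x.2 y y.2⟩
  have hK : K.PosSemidef := by
    have htfae := (RKHS.posSemidef_tfae (K := K)).out 0 2
    refine htfae.2 ⟨?_, fun vv => ?_⟩
    · ext x y ξ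
      refine ext_inner_right ℂ fun η => ?_
      rw [Matrix.conjTranspose_apply, ContinuousLinearMap.star_eq_adjoint,
        ContinuousLinearMap.adjoint_inner_left]
      -- Hermitian symmetry of `K` comes from positivity on the two points `y`, `x`.
      have hmem : ∀ i j : Fin 2, ((![(y : G), x] i)⁻¹ * ![(y : G), x] j) ∈ S := fun i j =>
        hF _ (by fin_cases i <;> simp) _ (by fin_cases j <;> simp)
      exact (inner_eq_of_opPosSemidef (hφ 2 ![(y : G), x] hmem) ξ η).symm
    · let e := F.equivFin
      have h := hφ F.card (fun i => (e.symm i : G)) (fun i j => hF _ (e.symm i).2 _ (e.symm j).2)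
        (fun i => vv (e.symm i))
      rw [Finsupp.sum_fintype _ _ (by simp)]
      simp only [Finsupp.sum_fintype _ _ (fun _ => inner_zero_right _)]
      refine (Complex.nonneg_iff.1 h).1.trans_eq ?_
      rw [← RCLike.re_eq_complex_re]
      simp only [map_sum]
      rw [Finset.sum_comm (s := (Finset.univ : Finset F))]
      refine Fintype.sum_equiv e.symm _ _ fun i => Fintype.sum_equiv e.symm _ _ fun j => ?_
      exact inner_re_symm _ _
  have : Fact K.PosSemidef := ⟨hK⟩
  refine ⟨RKHS.OfKernel K, inferInstance, inferInstance, inferInstance,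
    fun x => if h : x ∈ F then RKHS.kerFun (RKHS.OfKernel K) ⟨x, h⟩ else 0, ?_⟩
  intro x hx y hy h ξ η
  simp only [hx, hy, dif_pos]
  rw [← ContinuousLinearMap.adjoint_inner_right, ← ContinuousLinearMap.comp_apply,
    ← RKHS.kernel_apply, RKHS.OfKernel.kernel_ofKernel]
  rfl

/-- Over a finite set of vertices of a chordal Cayley graph, a partially positive definite function
is a Gram kernel. -/
theorem IsPosDefOn.exists_gram {G : Type u} [Group G] {S : Set G} {H : Type v}
    [NormedAddCommGroup H] [InnerProductSpace ℂ H] [CompleteSpace H] {φ : S → H →L[ℂ] H}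
    (hφ : IsPosDefOn S φ) (hS : IsSymmetricSet S) (hΓ : IsChordal (SimpleGraph.mulCayley S))
    (F : Finset G) :
    ∃ (E : Type (max u v)) (_ : NormedAddCommGroup E) (_ : InnerProductSpace ℂ E)
      (_ : CompleteSpace E) (W : G → H →L[ℂ] E), ∀ x ∈ F, ∀ y ∈ F, ∀ h : x⁻¹ * y ∈ S,
        ∀ ξ η, inner ℂ (W x ξ) (W y η) = inner ℂ ξ (φ ⟨x⁻¹ * y, h⟩ η) := by
  classical
  induction F using Finset.strongInduction with
  | H F ih =>
    by_cases hF : (SimpleGraph.mulCayley S).IsClique (F : Set G)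
    · exact hφ.exists_gram_of_isClique F fun x hx y hy => hS.mem_of_isClique hF hx hy
    obtain ⟨A, B, hAB, hAF, hBF, hclique, hsep⟩ := hΓ.exists_clique_separation F hF
    obtain ⟨E₁, _, _, _, W₁, hW₁⟩ := ih A hAF
    obtain ⟨E₂, _, _, _, W₂, hW₂⟩ := ih B hBF
    obtain ⟨W, hWA, hWB⟩ := exists_amalgamation (A : Set G) (B : Set G) W₁ W₂ (by
      intro x hx y hy ξ η
      have h := hS.mem_of_isClique hclique hx hy
      rw [hW₁ x hx.1 y hy.1 h, hW₂ x hx.2 y hy.2 h])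
    refine ⟨WithLp 2 (E₁ × E₂), inferInstance, inferInstance, inferInstance, W, ?_⟩
    intro x hx y hy h ξ η
    -- A pair contained in neither piece is not an edge, so nothing is prescribed there.
    have hadj : ∀ {a b : G}, a ∈ A → a ∉ B → b ∈ B → b ∉ A →
        ¬ (a⁻¹ * b ∈ S ∨ b⁻¹ * a ∈ S) := fun ha ha' hb hb' hab =>
      hsep _ ha ha' _ hb hb' ((SimpleGraph.mulCayley_adj S _ _).2
        ⟨fun h => ha' (h ▸ hb), hab⟩)
    rw [← hAB, Finset.mem_union] at hx hy
    by_cases hA : x ∈ A ∧ y ∈ A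
    · rw [hWA x hA.1 y hA.2, hW₁ x hA.1 y hA.2 h]
    by_cases hB : x ∈ B ∧ y ∈ B
    · rw [hWB x hB.1 y hB.2, hW₂ x hB.1 y hB.2 h]
    exfalso
    have h₁ := @hadj x y
    have h₂ := @hadj y x
    tauto

theorem opPosSemidef_gram [CompleteSpace H] {E : Type*} [NormedAddCommGroup E]
    [InnerProductSpace ℂ E] [CompleteSpace E] {n : ℕ} (W : Fin n → H →L[ℂ] E) :
    OpPosSemidef (Matrix.of fun i j => (W i).adjoint ∘L W j) := by
  intro ξ
  have : ∑ i, ∑ j, inner ℂ (ξ i) ((Matrix.of fun i j => (W i).adjoint ∘L W j) i j (ξ j)) =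
      inner ℂ (∑ i, W i (ξ i)) (∑ j, W j (ξ j)) := by
    simp only [sum_inner, inner_sum, Matrix.of_apply, ContinuousLinearMap.comp_apply,
      ContinuousLinearMap.adjoint_inner_right]
    exact Finset.sum_comm
  rw [this, inner_self_eq_norm_sq_to_K, ← RCLike.ofReal_pow]
  exact Complex.zero_le_real.2 (sq_nonneg ‖∑ i, W i (ξ i)‖)

/-- A bounded kernel on `G` that extends `φ` over a finite set of vertices. -/
theorem IsPosDefOn.exists_kernel_of_finset [CompleteSpace H] (hφ : IsPosDefOn S φ)
    (hS : IsSymmetricSet S) (hΓ : IsChordal (SimpleGraph.mulCayley S)) (F : Finset G) :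
    ∃ K : G → G → H →L[ℂ] H,
      (∀ (n : ℕ) (g : Fin n → G), OpPosSemidef (Matrix.of fun i j => K (g i) (g j))) ∧
      (∀ x y, ‖K x y‖ ≤ ‖φ ⟨1, hS.1⟩‖) ∧
      ∀ x ∈ F, ∀ y ∈ F, ∀ h : x⁻¹ * y ∈ S, K x y = φ ⟨x⁻¹ * y, h⟩ := by
  classical
  obtain ⟨E, _, _, _, W₀, hW₀⟩ := hφ.exists_gram hS hΓ F
  -- Cutting off outside `F` makes the norm bound independent of `F`.
  let W : G → H →L[ℂ] E := fun x => if x ∈ F then W₀ x else 0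
  have hWF : ∀ x ∈ F, ∀ y ∈ F, ∀ h : x⁻¹ * y ∈ S,
      (W x).adjoint ∘L W y = φ ⟨x⁻¹ * y, h⟩ := by
    intro x hx y hy h
    ext η
    refine ext_inner_left ℂ fun ξ => ?_
    rw [ContinuousLinearMap.comp_apply, ContinuousLinearMap.adjoint_inner_right]
    simpa only [W, hx, hy, if_true] using hW₀ x hx y hy h ξ η
  have hnorm : ∀ x, ‖W x‖ * ‖W x‖ ≤ ‖φ ⟨1, hS.1⟩‖ := by
    intro x
    by_cases hx : x ∈ F
    · have h1 : x⁻¹ * x ∈ S := by simpa using hS.1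
      rw [← ContinuousLinearMap.norm_adjoint_comp_self, hWF x hx x hx h1]
      simp
    · simp [W, hx]
  refine ⟨fun x y => (W x).adjoint ∘L W y, fun n g => opPosSemidef_gram fun i => W (g i),
    fun x y => ?_, hWF⟩
  have h₁ : ‖(W x).adjoint ∘L W y‖ ≤ ‖W x‖ * ‖W y‖ := by
    simpa using ContinuousLinearMap.opNorm_comp_le (W x).adjoint (W y)
  nlinarith [hnorm x, hnorm y, sq_nonneg (‖W x‖ - ‖W y‖)]

/-- A bounded positive definite kernel on `G` that extends `φ`. -/
theorem IsPosDefOn.exists_kernel [CompleteSpace H] (hφ : IsPosDefOn S φ)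
    (hS : IsSymmetricSet S) (hΓ : IsChordal (SimpleGraph.mulCayley S)) :
    ∃ K : G → G → H →L[ℂ] H,
      (∀ (n : ℕ) (g : Fin n → G), OpPosSemidef (Matrix.of fun i j => K (g i) (g j))) ∧
      (∃ C, ∀ x y, ‖K x y‖ ≤ C) ∧
      ∀ x y, ∀ h : x⁻¹ * y ∈ S, K x y = φ ⟨x⁻¹ * y, h⟩ := by
  classical
  choose K hK hKC hKφ using hφ.exists_kernel_of_finset hS hΓ
  -- The ultrafilter refines `atTop`, so almost every `F` contains both `x` and `y`, where `K F x y`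
  -- has its prescribed value.
  obtain ⟨m, hm, hmlim⟩ := exists_isState_of_ultrafilter
    (Ultrafilter.of (Filter.atTop : Filter (Finset G)))
  have havg : ∀ x y, ∃ A, IsAverage m (fun F => K F x y) A := fun x y =>
    hm.exists_isAverage fun F => hKC F x y
  choose A hA using havg
  refine ⟨A, fun n g => hm.opPosSemidef (fun i j => hA (g i) (g j)) fun F => hK F n g,
    ⟨_, fun x y => (hA x y).norm_le hm (norm_nonneg _) fun F => hKC F x y⟩, fun x y h => ?_⟩
  ext η
  refine ext_inner_left ℂ fun ξ => ?_
  obtain ⟨hb, hAη⟩ := hA x y ξ η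
  rw [hAη]
  refine hmlim _ _ (Filter.Eventually.filter_mono (Ultrafilter.of_le _) ?_)
  filter_upwards [Filter.eventually_ge_atTop ({x, y} : Finset G)] with F hF
  rw [hKφ F x (hF (by simp)) y (hF (by simp)) h]

end Extension

end PosDefExtension

theorem theorem2p1 {G : Type*} [Group G] (hG : PosDefExtension.IsAmenable G)
    (S : Set G) (hS : PosDefExtension.IsSymmetricSet S)
    (hchordal : PosDefExtension.IsChordal (SimpleGraph.mulCayley S))
    {H : Type*} [NormedAddCommGroup H] [InnerProductSpace ℂ H] [CompleteSpace H]
    (φ : S → H →L[ℂ] H) (hφ : PosDefExtension.IsPosDefOn S φ) :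
    ∃ Φ : G → H →L[ℂ] H,
      PosDefExtension.IsPosDef Φ ∧ ∀ s : S, Φ s = φ s := by
  obtain ⟨m, hm⟩ := hG
  obtain ⟨K, hK, ⟨C, hC⟩, hKφ⟩ := hφ.exists_kernel hS hchordal
  have havg : ∀ g, ∃ A, PosDefExtension.IsAverage m (fun y => K y (y * g)) A := fun g =>
    hm.isState.exists_isAverage fun y => hC y (y * g)
  choose Φ hΦ using havg
  refine ⟨Φ, fun n g => ?_, fun s => ?_⟩
  · refine hm.isState.opPosSemidef (T := fun i j y => K (y * g i) (y * g j)) (fun i j => ?_)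
      fun y => hK n fun i => y * g i
    -- Substituting `y * g i` for `y` turns `K y (y * ((g i)⁻¹ * g j))` into `K (y * g i) (y * g
    -- j)`.
    simpa [mul_assoc] using (hΦ ((g i)⁻¹ * g j)).comp_mul_right hm (g i)
  · ext η
    refine ext_inner_left ℂ fun ξ => ?_
    obtain ⟨hb, hΦη⟩ := hΦ s ξ η
    have hconst : (⟨_, hb⟩ : lp (fun _ : G => ℂ) ∞) = (inner ℂ ξ (φ s η) : ℂ) • 1 := by
      ext y
      change inner ℂ ξ (K y (y * s) η) = inner ℂ ξ (φ s η) * 1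
      have hs : y⁻¹ * (y * s) ∈ S := by simp
      rw [hKφ y (y * s) hs, mul_one]
      simp
    rw [hΦη, hconst, map_smul, hm.map_one, smul_eq_mul, mul_one]
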